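/- Let $R$ be an irreducible (reduced, crystallographic) root system in a Euclidean space $E$ of dimension $n$ with inner product $(\cdot,\cdot)$, let $G$ be its Weyl group and let $R^+$ be a choice of positive roots. Put $$h=\frac1n\sum_{r\in R^+}(r,r),\qquad W=\{x\in E:\ (x,r)/h\in\mathbb Z\ \text{for all } r\in R\},\qquad \beta(x,y)=(x,y)/h,\qquad w=\frac12\sum_{r\in R^+}r .$$ Let $W_{\mathrm{ev}}=\{x\in W:\tfrac12\beta(x,x)\in\mathbb Z\}$, and let $W^\bullet=\{r\in E:\ \tfrac12\beta(x,x)\equiv\beta(r,x)\bmod\mathbb Z\ \text{for all } x\in W\}$ be the shadow of $(W,\beta)$. Then: 1. $(W,\beta)$ is an integral lattice of rank $n$, and $R^+$ is a eutactic star on it: the elements of $R^+$ are non-zero vectors of the dual lattice of $(W,\beta)$, and $x=\sum_{r\in R^+}\beta(r,x)\,r$ for all $x\in E$. 2. $G$ acts on $(W,\beta)$ by isometries and leaves $R^+$ invariant up to signs, i.e. each $g\in G$ satisfies $g r=\epsilon_r\,\sigma(r)$ $(r\in R^+)$ for some permutation $\sigma$ of $R^+$ and signs $\epsilon_r\in\{\pm1\}$.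 The number $\operatorname{sn}(g)=\prod_{r\in R^+}\epsilon_r$, which depends only on $g$, equals $(-1)^{\ell(g)}$, where $\ell(g)$ is the number of $r\in R^+$ such that $gr$ is negative. 3. The eutactic star $R^+$ on $(W,\beta)$ is $G$-extremal: there is exactly one $G$-orbit in $W^\bullet/W_{\mathrm{ev}}$ whose elements have their stabilizers in the kernel of $\operatorname{sn}$. Moreover, $w\in W^\bullet$, and this orbit is the orbit of $w+W_{\mathrm{ev}}$. -/

import Mathlib

open scoped Pointwise

noncomputable section

/-! ### Integral lattices, shadows and extremal eutactic stars

A lattice `L` of rank `n` is realised inside the real vector space `V = ℝ ⊗ L` of dimension `n`, and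
its bilinear form is extended to `V`.  For an integral lattice (free of full rank, non-degenerate
form) every vector of `V` pairing rationally with `L` lies in `ℚ ⊗ L`, so that dual lattice and
shadow may be formed in `V`. -/

namespace ThetaLattice

open Module

variable {V : Type*} [AddCommGroup V] [Module ℝ V]

/-- `(L, β)` is an integral lattice with `ℝ ⊗ L = V`. -/
structure IsIntegralLattice (β : LinearMap.BilinForm ℝ V) (L : Submodule ℤ V) : Prop where
  free : ∃ e : Basis (Fin (finrank ℝ V)) ℝ V, L = Submodule.span ℤ (Set.range e)
  symm : ∀ x y, β x y = β y x
  nondegenerate : β.Nondegenerate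
  integral : ∀ x ∈ L, ∀ y ∈ L, ∃ m : ℤ, β x y = m

/-- The even part `L_ev`: the elements `x` of `L` for which `β(x) = β(x,x)/2` is an integer. -/
def evenPart (β : LinearMap.BilinForm ℝ V) (L : Submodule ℤ V) : Set V :=
  {x | x ∈ L ∧ ∃ m : ℤ, β x x / 2 = m}

/-- The shadow of `(L, β)`: all `r` with `β(x,x)/2 ≡ β(r,x) mod ℤ` for every `x` in `L`. -/
def shadow (β : LinearMap.BilinForm ℝ V) (L : Submodule ℤ V) : Set V :=
  {r | ∀ x ∈ L, ∃ m : ℤ, β x x / 2 - β r x = m}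

/-- The coset `v + L_ev`. -/
def evenCoset (β : LinearMap.BilinForm ℝ V) (L : Submodule ℤ V) (v : V) : Set V :=
  v +ᵥ evenPart β L

/-- The quotient `shadow / L_ev`, as a set of cosets.  A group of linear automorphisms acts on
cosets by taking images. -/
def shadowCosets (β : LinearMap.BilinForm ℝ V) (L : Submodule ℤ V) : Set (Set V) :=
  evenCoset β L '' shadow β L

/-- A eutactic star on `(L, β)`: a finite family of non-zero vectors `s j` in the dual lattice with
`x = ∑ j, β(s j, x) s j` for all `x`. -/
structure IsEutacticStar (β : LinearMap.BilinForm ℝ V) (L : Submodule ℤ V)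
    {J : Type*} [Fintype J] (s : J → V) : Prop where
  ne_zero : ∀ j, s j ≠ 0
  mem_dual : ∀ j, s j ∈ β.dualSubmodule L
  expansion : ∀ x, x = ∑ j, β (s j) x • s j

/-- The permutation `σ` and the signs `ε` describe the action of `g` on the star `s`:
`g (s j) = ε j • s (σ j)`. -/
def IsSignedPerm {J : Type*} (s : J → V) (g : V ≃ₗ[ℝ] V) (σ : Equiv.Perm J) (ε : J → ℤˣ) : Prop :=
  ∀ j, g (s j) = (ε j : ℤ) • s (σ j)

open Classical in
/-- The sign `sn(g) = ∏ j, ε j`, where `g (s j) = ε j • s (σ j)` for a permutation `σ` and signs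
`ε`.  (It is independent of the choice by `sn_eq`; it is `1` if there is no such description.) -/
def sn {J : Type*} [Fintype J] (s : J → V) (g : V ≃ₗ[ℝ] V) : ℤˣ :=
  if h : ∃ p : Equiv.Perm J × (J → ℤˣ), IsSignedPerm s g p.1 p.2 then ∏ j, h.choose.2 j else 1

/-- There is a choice of one vector from each pair `{v, -v}` of opposite non-zero vectors. -/
lemma exists_sign (V : Type*) [AddCommGroup V] [Module ℝ V] :
    ∃ η : V → ℤˣ, ∀ v, v ≠ 0 → η (-v) = -η v := by
  classical
  refine ⟨fun v => if WellOrderingRel v (-v) then 1 else -1, fun v hv => ?_⟩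
  have hne : v ≠ -v := by
    intro h
    have h2 : (2 : ℝ) • v = 0 := by
      rw [two_smul]
      nth_rewrite 2 [h]
      exact add_neg_cancel v
    exact hv ((smul_eq_zero.mp h2).resolve_left two_ne_zero)
  rcases trichotomous_of (WellOrderingRel (α := V)) v (-v) with h | h | h
  · have h' : ¬ WellOrderingRel (-v) v := asymm_of _ h
    simp [h, h']
  · exact absurd h hne
  · have h' : ¬ WellOrderingRel v (-v) := asymm_of _ h
    simp [h, h']

lemma sn_eq {J : Type*} [Fintype J] {s : J → V} (hs : ∀ j, s j ≠ 0) {g : V ≃ₗ[ℝ] V}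
    {σ : Equiv.Perm J} {ε : J → ℤˣ} (h : IsSignedPerm s g σ ε) : sn s g = ∏ j, ε j := by
  have hex : ∃ p : Equiv.Perm J × (J → ℤˣ), IsSignedPerm s g p.1 p.2 := ⟨(σ, ε), h⟩
  obtain ⟨η, hη⟩ := exists_sign V
  have key : ∀ (τ : Equiv.Perm J) (δ : J → ℤˣ), IsSignedPerm s g τ δ →
      ∏ j, η (g (s j)) = (∏ j, δ j) * ∏ j, η (s j) := by
    intro τ δ hδ
    have h1 : ∀ j, η (g (s j)) = δ j * η (s (τ j)) := by
      intro j
      rw [hδ j]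
      rcases Int.units_eq_one_or (δ j) with h | h
      · simp [h]
      · simp [h, hη _ (hs _)]
    simp_rw [h1, Finset.prod_mul_distrib]
    rw [Equiv.prod_comp τ (fun j => η (s j))]
  rw [sn, dif_pos hex]
  exact mul_right_cancel ((key _ _ hex.choose_spec).symm.trans (key _ _ h))

/-- All elements of `G` that fix the coset `c` lie in the kernel of `sn`. -/
def StabilizerInKernel {J : Type*} [Fintype J] (G : Subgroup (V ≃ₗ[ℝ] V)) (s : J → V)
    (c : Set V) : Prop :=
  ∀ g : G, g ∈ MulAction.stabilizer G c → sn s (g : V ≃ₗ[ℝ] V) = 1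

/-- `s` is a `G`-extremal eutactic star on the integral lattice `(L, β)`: the group `G` consists of
isometries of `(L, β)`, leaves `s` invariant up to signs, and there is exactly one `G`-orbit `O` in
`shadow / L_ev` whose elements have their stabilizers in the kernel of `sn`. -/
structure IsExtremalStar (G : Subgroup (V ≃ₗ[ℝ] V)) (β : LinearMap.BilinForm ℝ V)
    (L : Submodule ℤ V) {J : Type*} [Fintype J] (s : J → V) : Prop where
  lattice : IsIntegralLattice β L
  star : IsEutacticStar β L s
  isometry : ∀ g ∈ G, ∀ x y, β (g x) (g y) = β x y
  maps_lattice : ∀ g ∈ G, ∀ x, g x ∈ L ↔ x ∈ L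
  signedPerm : ∀ g ∈ G, ∃ σ ε, IsSignedPerm s g σ ε
  existsUnique_orbit : ∃! O : Set (Set V),
    (∃ c ∈ shadowCosets β L, O = MulAction.orbit G c) ∧ ∀ c ∈ O, StabilizerInKernel G s c

end ThetaLattice

/-! ### The lattice attached to a root system -/

namespace RootPairing

open Module

variable {ι E N : Type*} [Fintype ι] [NormedAddCommGroup E] [InnerProductSpace ℝ E]
  [AddCommGroup N] [Module ℝ N] {P : RootPairing ι ℝ E N}

open Classical in
/-- The positive roots `R⁺` with respect to a base (as a set of indices). -/
def Base.posRoots (b : P.Base) : Finset ι := Finset.univ.filter fun i => b.IsPos i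

/-- The family of positive roots. -/
def Base.posStar (b : P.Base) : b.posRoots → E := fun i => P.root i

/-- The number `h = (1/n) ∑_{r ∈ R⁺} (r,r)`. -/
def Base.normH (b : P.Base) : ℝ :=
  (1 / (finrank ℝ E : ℝ)) * ∑ i ∈ b.posRoots, inner ℝ (P.root i) (P.root i)

/-- The bilinear form `(x,y)/h`. -/
def Base.latticeForm (b : P.Base) : LinearMap.BilinForm ℝ E := (b.normH)⁻¹ • innerₗ E

/-- The lattice `W = {x ∈ E : (x,r)/h ∈ ℤ for all roots r}`. -/
def Base.lattice (b : P.Base) : Submodule ℤ E where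
  carrier := {x | ∀ i, ∃ m : ℤ, inner ℝ x (P.root i) / b.normH = m}
  add_mem' {x y} hx hy i := by
    obtain ⟨m, hm⟩ := hx i
    obtain ⟨k, hk⟩ := hy i
    exact ⟨m + k, by rw [inner_add_left, add_div, hm, hk]; push_cast; ring⟩
  zero_mem' i := ⟨0, by simp⟩
  smul_mem' c x hx i := by
    obtain ⟨m, hm⟩ := hx i
    refine ⟨c * m, ?_⟩
    rw [← Int.cast_smul_eq_zsmul ℝ c x, real_inner_smul_left, mul_div_assoc, hm]
    push_cast
    ring

/-- The Weyl vector: half the sum of the positive roots. -/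
def Base.weylVector (b : P.Base) : E := (1 / 2 : ℝ) • ∑ i ∈ b.posRoots, P.root i

/-- The length of `g`: the number of positive roots `r` such that `g r` is a negative root. -/
def Base.length (b : P.Base) (g : E ≃ₗ[ℝ] E) : ℕ :=
  Set.ncard {i | i ∈ b.posRoots ∧ ∃ j ∈ b.posRoots, g (P.root i) = -P.root j}

variable (P) in
/-- The Weyl group, as the group of linear automorphisms of `E` generated by the reflections. -/
def weylGL : Subgroup (E ≃ₗ[ℝ] E) := Subgroup.closure (Set.range P.reflection)

end RootPairing

end

/-! The operator x ↦ ∑ (r,x) r over all roots commutes with the Weyl group, so by irreducibility it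
is a scalar, and its trace identifies the scalar as 2h (`sum_inner_smul_root`). Hence β(x,y) = ∑
β(x,r) β(y,r) over R⁺ (`latticeForm_eq_sum`). This gives integrality of W, and since m² ≡ m mod 2 it
also puts w in the shadow. The dual of W is the root lattice Q, so the shadow lies in w + Q.

Everything else rests on 0 < (w,r) < h for positive r. The upper bound comes from
`normH_sub_inner_weylVector`, which writes h − (w,r) as a positive multiple of a sum of terms p² − p
with p an integer.

Stabilizer of w: if x = gw − w lies in W_ev, the bounds force β(x,r) to be −1 when g⁻¹r is negative
and 0 otherwise. So β(x,x) = ℓ(g⁻¹), which is then even, and sn(g) = 1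
(`sn_eq_one_of_map_weylVector_sub_mem`).

Uniqueness: W_ev ⋊ G contains the reflections in all hyperplanes (x,r) = kh. A shadow vector v on
such a hyperplane has the class of v fixed by a reflection, whose sign is −1 (`sn_reflection`). If v
lies on none of them, it can be moved into the alcove of w, where 0 < (x,r) < h for all r in R⁺
(`exists_map_sub_weylVector_mem`). The only point of w + Q there is w
(`eq_weylVector_of_inner_mem_Ioo`). -/

noncomputable section

/-! ### Invariant inner product and the eutactic identity -/

namespace RootPairing

open Module

variable {ι E N : Type*} [NormedAddCommGroup E] [InnerProductSpace ℝ E]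
  [AddCommGroup N] [Module ℝ N] {P : RootPairing ι ℝ E N}

variable (P) in
/-- The inner product is invariant under the reflections of `P`. -/
def IsInvariantInner : Prop :=
  ∀ i x y, inner ℝ (P.reflection i x) (P.reflection i y) = inner ℝ x y

lemma inner_root_self_pos (i : ι) : 0 < inner ℝ (P.root i) (P.root i) :=
  real_inner_self_pos.mpr (P.ne_zero i)

lemma IsInvariantInner.two_mul_inner_root (hP : P.IsInvariantInner) (i : ι) (x : E) :
    2 * inner ℝ x (P.root i) = P.coroot' i x * inner ℝ (P.root i) (P.root i) := by
  have h := hP i x (P.root i)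
  rw [reflection_apply_self, reflection_apply, inner_sub_left, inner_neg_right, inner_neg_right,
    real_inner_smul_left] at h
  linarith

lemma finiteDimensional_of_isRootSystem [Finite ι] (P : RootPairing ι ℝ E N) [P.IsRootSystem] :
    FiniteDimensional ℝ E := by
  refine ⟨?_⟩
  rw [← IsRootSystem.span_root_eq_top (P := P)]
  exact Submodule.fg_span (Set.finite_range _)

lemma nonempty_of_isIrreducible (P : RootPairing ι ℝ E N) [P.IsRootSystem] [P.IsIrreducible] :
    Nonempty ι := by
  have := IsIrreducible.nontrivial (P := P)
  by_contra h
  rw [not_nonempty_iff] at h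
  have := IsRootSystem.span_root_eq_top (P := P)
  rw [Set.range_eq_empty, Submodule.span_empty] at this
  exact bot_ne_top this

variable [Fintype ι]

namespace Base

variable (b : P.Base)

lemma mem_posRoots {i : ι} : i ∈ b.posRoots ↔ b.IsPos i := by
  simp [posRoots]

lemma reflectionPerm_self_mem_posRoots {i : ι} :
    P.reflectionPerm i i ∈ b.posRoots ↔ i ∉ b.posRoots := by
  rw [mem_posRoots, mem_posRoots]
  exact IsPos.neg_iff_not b i

/-- The map `i ↦ P.reflectionPerm i i` is r ↦ −r, which exchanges positive and negative roots. -/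
lemma sum_univ_eq_two_nsmul {A : Type*} [AddCommMonoid A] (F : ι → A)
    (hF : ∀ i, F (P.reflectionPerm i i) = F i) : ∑ i, F i = 2 • ∑ i ∈ b.posRoots, F i := by
  classical
  rw [← Finset.sum_add_sum_compl b.posRoots F, two_nsmul]
  congr 1
  refine Finset.sum_nbij' (fun i => P.reflectionPerm i i) (fun i => P.reflectionPerm i i)
    ?_ ?_ ?_ ?_ ?_
  · intro i hi
    rw [reflectionPerm_self_mem_posRoots]
    simpa using hi
  · intro i hi
    rw [Finset.mem_compl, reflectionPerm_self_mem_posRoots]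
    simpa using hi
  · intro i _
    exact P.indexNeg.neg_neg i
  · intro i _
    exact P.indexNeg.neg_neg i
  · intro i _
    exact (hF i).symm

end Base

/-- The endomorphism `x ↦ ∑ (r, x) r`, summed over all roots. -/
def sumRoots (P : RootPairing ι ℝ E N) : E →ₗ[ℝ] E :=
  ∑ i, (innerₗ E (P.root i)).smulRight (P.root i)

lemma sumRoots_apply (x : E) : P.sumRoots x = ∑ i, inner ℝ (P.root i) x • P.root i := by
  simp [sumRoots]

lemma IsInvariantInner.sumRoots_reflection (hP : P.IsInvariantInner) (i : ι) (x : E) :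
    P.sumRoots (P.reflection i x) = P.reflection i (P.sumRoots x) := by
  rw [sumRoots_apply, sumRoots_apply, map_sum, ← Equiv.sum_comp (P.reflectionPerm i)]
  refine Finset.sum_congr rfl fun j _ => ?_
  rw [root_reflectionPerm, hP, map_smul]

lemma isSymmetric_sumRoots : P.sumRoots.IsSymmetric := by
  intro x y
  rw [sumRoots_apply, sumRoots_apply, sum_inner, inner_sum]
  refine Finset.sum_congr rfl fun j _ => ?_
  rw [real_inner_smul_left, real_inner_smul_right, real_inner_comm x]
  ring

/-- A Schur argument: a symmetric operator has a real eigenvalue, and an eigenspace of an operator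
commuting with the reflections is invariant, hence everything. -/
lemma IsInvariantInner.exists_sumRoots_eq_smul (hP : P.IsInvariantInner) [P.IsRootSystem]
    [P.IsIrreducible] : ∃ μ : ℝ, ∀ x, P.sumRoots x = μ • x := by
  have := IsIrreducible.nontrivial (P := P)
  have := finiteDimensional_of_isRootSystem P
  obtain ⟨μ, hμ⟩ : ∃ μ : ℝ, End.HasEigenvalue P.sumRoots μ :=
    ⟨_, isSymmetric_sumRoots.hasEigenvalue_iSup_of_finiteDimensional⟩
  refine ⟨μ, fun x => ?_⟩
  have htop : End.eigenspace P.sumRoots μ = ⊤ := by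
    refine IsIrreducible.eq_top_of_invtSubmodule_reflection (P := P) _ (fun i y hy => ?_) hμ
    rw [End.mem_eigenspace_iff] at hy
    rw [Submodule.mem_comap, End.mem_eigenspace_iff]
    rw [LinearEquiv.coe_coe, hP.sumRoots_reflection, hy, map_smul]
  exact End.mem_eigenspace_iff.mp (htop ▸ Submodule.mem_top)

namespace Base

variable (b : P.Base)

/-- The trace determines the scalar: each rank-one summand contributes (r,r), so the scalar for the
sum over all roots is 2h, and R⁺ accounts for half of it. -/
lemma sum_inner_smul_root (hP : P.IsInvariantInner) [P.IsRootSystem] [P.IsIrreducible] (x : E) :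
    ∑ i ∈ b.posRoots, inner ℝ (P.root i) x • P.root i = b.normH • x := by
  have := IsIrreducible.nontrivial (P := P)
  have := finiteDimensional_of_isRootSystem P
  obtain ⟨μ, hμ⟩ := hP.exists_sumRoots_eq_smul
  have hn : (finrank ℝ E : ℝ) ≠ 0 := by exact_mod_cast finrank_pos.ne'
  have htr : μ * finrank ℝ E = 2 * ∑ i ∈ b.posRoots, inner ℝ (P.root i) (P.root i) := by
    have h1 : P.sumRoots = μ • LinearMap.id := LinearMap.ext fun x => by simp [hμ]
    have h2 := congrArg (LinearMap.trace ℝ E) h1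
    rw [map_smul, LinearMap.trace_id, smul_eq_mul] at h2
    rw [← h2, sumRoots, map_sum]
    simp_rw [LinearMap.trace_smulRight]
    rw [b.sum_univ_eq_two_nsmul _ (by simp)]
    simp
  have hx := hμ x
  rw [sumRoots_apply, b.sum_univ_eq_two_nsmul _ (by simp), ← Nat.cast_smul_eq_nsmul ℝ] at hx
  have h3 : μ = 2 * b.normH := by
    rw [normH]
    field_simp
    exact htr
  rw [h3, mul_smul] at hx
  exact smul_right_injective E (two_ne_zero' ℝ) (by simpa using hx)

lemma sum_inner_mul_inner (hP : P.IsInvariantInner) [P.IsRootSystem] [P.IsIrreducible] (x y : E) :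
    ∑ i ∈ b.posRoots, inner ℝ x (P.root i) * inner ℝ y (P.root i) = b.normH * inner ℝ x y := by
  have h := congrArg (fun z => inner ℝ z y) (b.sum_inner_smul_root hP x)
  simp only [sum_inner, real_inner_smul_left] at h
  rw [← h]
  refine Finset.sum_congr rfl fun i _ => ?_
  rw [real_inner_comm, real_inner_comm y]

lemma normH_pos [P.IsRootSystem] [P.IsIrreducible] : 0 < b.normH := by
  have := IsIrreducible.nontrivial (P := P)
  have := finiteDimensional_of_isRootSystem P
  have hn : (0 : ℝ) < finrank ℝ E := by exact_mod_cast finrank_pos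
  obtain ⟨i⟩ := nonempty_of_isIrreducible P
  refine mul_pos (by positivity) (Finset.sum_pos (fun i _ => inner_root_self_pos i) ?_)
  by_cases hi : i ∈ b.posRoots
  · exact ⟨i, hi⟩
  · exact ⟨_, b.reflectionPerm_self_mem_posRoots.mpr hi⟩

end Base

end RootPairing

/-! ### Integrality of pairings and bounds for the Weyl vector -/

namespace RootPairing

open Module

variable {ι E N : Type*} [NormedAddCommGroup E] [InnerProductSpace ℝ E]
  [AddCommGroup N] [Module ℝ N] {P : RootPairing ι ℝ E N}

lemma exists_int_coroot'_eq [P.IsCrystallographic] (i : ι) {x : E}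
    (hx : x ∈ Submodule.span ℤ (Set.range P.root)) : ∃ m : ℤ, P.coroot' i x = m := by
  induction hx using Submodule.span_induction with
  | mem x hx =>
    obtain ⟨j, rfl⟩ := hx
    exact ⟨P.pairingIn ℤ j i, by rw [root_coroot'_eq_pairing, ← P.algebraMap_pairingIn ℤ]; simp⟩
  | zero => exact ⟨0, by simp⟩
  | add x y _ _ hx hy =>
    obtain ⟨m, hm⟩ := hx
    obtain ⟨k, hk⟩ := hy
    exact ⟨m + k, by rw [map_add, hm, hk]; push_cast; ring⟩
  | smul c x _ hx =>
    obtain ⟨m, hm⟩ := hx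
    exact ⟨c * m, by rw [map_zsmul, hm]; simp⟩

namespace Base

/-- Exhibits the root lattice as the ℤ-span of a real basis, the form needed for duality and for
discreteness. -/
lemma span_range_toWeightBasis (b : P.Base) [P.IsRootSystem] :
    Submodule.span ℤ (Set.range b.toWeightBasis) = Submodule.span ℤ (Set.range P.root) := by
  rw [← b.span_int_root_support]
  congr 1
  ext x
  simp

end Base

variable [Fintype ι]

namespace Base

variable (b : P.Base)

variable {b} in
lemma inner_root_nonneg_of_support [P.IsCrystallographic] {x : E}
    (hx : ∀ i ∈ b.support, 0 ≤ inner ℝ x (P.root i)) {i : ι} (hi : i ∈ b.posRoots) :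
    0 ≤ inner ℝ x (P.root i) := by
  refine IsPos.induction_on_add (b := b) (p := fun i => 0 ≤ inner ℝ x (P.root i))
    (b.mem_posRoots.mp hi) hx fun i j k hk hi hj => ?_
  rw [hk, inner_add_right]
  exact add_nonneg hi (hx j hj)

variable {b} in
lemma inner_root_pos_of_support [P.IsCrystallographic] {x : E}
    (hx : ∀ i ∈ b.support, 0 < inner ℝ x (P.root i)) {i : ι} (hi : i ∈ b.posRoots) :
    0 < inner ℝ x (P.root i) := by
  refine IsPos.induction_on_add (b := b) (p := fun i => 0 < inner ℝ x (P.root i))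
    (b.mem_posRoots.mp hi) hx fun i j k hk hi hj => ?_
  rw [hk, inner_add_right]
  exact add_pos hi (hx j hj)

/-- A simple reflection permutes the other positive roots and negates their pairings with `i`, so
these cancel and only `j = i` contributes. -/
lemma sum_pairing_of_mem_support [P.IsCrystallographic] [P.IsReduced] {i : ι}
    (hi : i ∈ b.support) : ∑ j ∈ b.posRoots, P.pairing j i = 2 := by
  classical
  have hpos : i ∈ b.posRoots := b.mem_posRoots.mpr (isPos_of_mem_support hi)
  have hmem : ∀ j ∈ b.posRoots.erase i, P.reflectionPerm i j ∈ b.posRoots.erase i := by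
    intro j hj
    rw [Finset.mem_erase, mem_posRoots] at hj ⊢
    refine ⟨fun h => ?_, hj.2.reflectionPerm hi hj.1⟩
    have h' : j = P.reflectionPerm i i := by
      rw [← reflectionPerm_self (P := P) i j, h]
    rw [h', ← b.mem_posRoots, b.reflectionPerm_self_mem_posRoots] at hj
    exact hj.2 hpos
  have hneg : ∑ j ∈ b.posRoots.erase i, P.pairing j i =
      -∑ j ∈ b.posRoots.erase i, P.pairing j i := by
    rw [← Finset.sum_neg_distrib]
    refine Finset.sum_nbij' (P.reflectionPerm i) (P.reflectionPerm i) hmem hmem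
      (by simp) (by simp) fun j _ => ?_
    rw [← pairing_reflectionPerm, pairing_reflectionPerm_self_right, neg_neg]
  rw [← Finset.add_sum_erase _ _ hpos, pairing_same]
  linarith

lemma coroot'_weylVector (i : ι) :
    P.coroot' i b.weylVector = 1 / 2 * ∑ j ∈ b.posRoots, P.pairing j i := by
  simp only [weylVector, map_smul, map_sum, root_coroot'_eq_pairing, smul_eq_mul]

lemma coroot'_weylVector_of_mem_support [P.IsCrystallographic] [P.IsReduced] {i : ι}
    (hi : i ∈ b.support) : P.coroot' i b.weylVector = 1 := by
  rw [coroot'_weylVector, b.sum_pairing_of_mem_support hi]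
  norm_num

lemma exists_int_coroot'_weylVector [P.IsCrystallographic] [P.IsReduced] (i : ι) :
    ∃ m : ℤ, P.coroot' i b.weylVector = m := by
  suffices ∀ c ∈ Submodule.span ℤ (P.coroot '' b.support),
      ∃ m : ℤ, P.toLinearMap b.weylVector c = m from this _ (b.coroot_mem_span_int i)
  intro c hc
  induction hc using Submodule.span_induction with
  | mem c hc =>
    obtain ⟨j, hj, rfl⟩ := hc
    exact ⟨1, by simpa using b.coroot'_weylVector_of_mem_support hj⟩
  | zero => exact ⟨0, by simp⟩
  | add x y _ _ hx hy =>
    obtain ⟨m, hm⟩ := hx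
    obtain ⟨k, hk⟩ := hy
    exact ⟨m + k, by rw [map_add, hm, hk]; push_cast; ring⟩
  | smul c x _ hx =>
    obtain ⟨m, hm⟩ := hx
    exact ⟨c * m, by rw [map_zsmul, hm]; simp⟩

lemma inner_weylVector_pos (hP : P.IsInvariantInner) [P.IsCrystallographic] [P.IsReduced] {i : ι}
    (hi : i ∈ b.posRoots) : 0 < inner ℝ b.weylVector (P.root i) := by
  refine inner_root_pos_of_support (b := b) (fun j hj => ?_) hi
  have h := hP.two_mul_inner_root j b.weylVector
  rw [b.coroot'_weylVector_of_mem_support hj] at h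
  have := inner_root_self_pos (P := P) j
  linarith

/-- With p the pairing of `j` with `i`, eutaxy applied to (r,r) gives h = (r,r)/4 · ∑ p², while the
definition of w gives (w,r) = (r,r)/4 · ∑ p. -/
lemma normH_sub_inner_weylVector (hP : P.IsInvariantInner) [P.IsRootSystem] [P.IsIrreducible]
    (i : ι) : b.normH - inner ℝ b.weylVector (P.root i) =
      inner ℝ (P.root i) (P.root i) / 4 * ∑ j ∈ b.posRoots, (P.pairing j i ^ 2 - P.pairing j i) := by
  have hr := inner_root_self_pos (P := P) i
  have h1 := hP.two_mul_inner_root i b.weylVector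
  rw [b.coroot'_weylVector] at h1
  have h2 := b.sum_inner_mul_inner hP (P.root i) (P.root i)
  have h3 : ∀ j, inner ℝ (P.root i) (P.root j) * inner ℝ (P.root i) (P.root j) =
      P.pairing j i ^ 2 * (inner ℝ (P.root i) (P.root i) ^ 2 / 4) := by
    intro j
    have h := hP.two_mul_inner_root i (P.root j)
    rw [root_coroot'_eq_pairing, real_inner_comm] at h
    linear_combination (inner ℝ (P.root i) (P.root j) / 2 +
      P.pairing j i * inner ℝ (P.root i) (P.root i) / 4) * h
  simp_rw [h3, ← Finset.sum_mul] at h2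
  rw [Finset.sum_sub_distrib]
  refine mul_right_cancel₀ hr.ne' ?_
  linear_combination -h2 - inner ℝ (P.root i) (P.root i) / 2 * h1

/-- For integral m the number m² − m is even and non-negative; the term `j = i` has m = 2 and makes
the sum positive. -/
lemma exists_int_sum_pairing_sq_sub [P.IsCrystallographic] (i : ι) :
    ∃ k : ℤ, ∑ j ∈ b.posRoots, (P.pairing j i ^ 2 - P.pairing j i) = 2 * k ∧
      (i ∈ b.posRoots → 0 < k) := by
  have h1 : ∀ m : ℤ, ∃ k : ℤ, m ^ 2 - m = 2 * k ∧ 0 ≤ k ∧ (m = 2 → 0 < k) := by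
    intro m
    obtain ⟨k, hk⟩ := Int.even_mul_pred_self m
    have h0 : m ^ 2 - m = 2 * k := by linear_combination hk
    refine ⟨k, h0, ?_, fun hm => by subst hm; omega⟩
    rcases le_or_gt m 0 with h | h
    · nlinarith
    · nlinarith
  choose f hf hf0 hf2 using h1
  refine ⟨∑ j ∈ b.posRoots, f (P.pairingIn ℤ j i), ?_, fun hi => ?_⟩
  · push_cast
    rw [Finset.mul_sum]
    refine Finset.sum_congr rfl fun j _ => ?_
    have h := hf (P.pairingIn ℤ j i)
    rw [← P.algebraMap_pairingIn ℤ]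
    simp only [algebraMap_int_eq, eq_intCast]
    exact_mod_cast h
  · exact Finset.sum_pos' (fun j _ => hf0 _) ⟨i, hi, hf2 _ (P.pairingIn_same ℤ i)⟩

lemma exists_int_normH_eq (hP : P.IsInvariantInner) [P.IsRootSystem] [P.IsIrreducible]
    [P.IsCrystallographic] (i : ι) :
    ∃ k : ℤ, b.normH = inner ℝ b.weylVector (P.root i) + k * (inner ℝ (P.root i) (P.root i) / 2) ∧
      (i ∈ b.posRoots → 0 < k) := by
  obtain ⟨k, hk, hk'⟩ := b.exists_int_sum_pairing_sq_sub i
  refine ⟨k, ?_, hk'⟩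
  have h := b.normH_sub_inner_weylVector hP i
  rw [hk] at h
  linear_combination h

lemma inner_weylVector_lt (hP : P.IsInvariantInner) [P.IsRootSystem] [P.IsIrreducible]
    [P.IsCrystallographic] {i : ι} (hi : i ∈ b.posRoots) :
    inner ℝ b.weylVector (P.root i) < b.normH := by
  obtain ⟨k, hk, hk'⟩ := b.exists_int_normH_eq hP i
  have := inner_root_self_pos (P := P) i
  have : (0 : ℝ) < k := by exact_mod_cast hk' hi
  rw [hk]
  linarith [mul_pos this (half_pos ‹0 < inner ℝ (P.root i) (P.root i)›)]

/-! ### The lattice and its dual -/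

lemma latticeForm_apply (x y : E) : b.latticeForm x y = inner ℝ x y / b.normH := by
  simp [latticeForm, div_eq_inv_mul]

lemma latticeForm_comm (x y : E) : b.latticeForm x y = b.latticeForm y x := by
  rw [latticeForm_apply, latticeForm_apply, real_inner_comm]

lemma latticeForm_nondegenerate [P.IsRootSystem] [P.IsIrreducible] :
    b.latticeForm.Nondegenerate := by
  have hh := b.normH_pos
  have h : ∀ x, (∀ y, b.latticeForm x y = 0) → x = 0 := fun x hx => by
    have := hx x
    rw [latticeForm_apply, div_eq_zero_iff] at this
    simpa [hh.ne'] using this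
  exact ⟨h, fun x hx => h x fun y => by rw [b.latticeForm_comm]; exact hx y⟩

lemma lattice_eq_dualSubmodule :
    b.lattice = b.latticeForm.dualSubmodule (Submodule.span ℤ (Set.range P.root)) := by
  ext x
  rw [LinearMap.BilinForm.mem_dualSubmodule]
  constructor
  · intro hx y hy
    induction hy using Submodule.span_induction with
    | mem y hy =>
      obtain ⟨i, rfl⟩ := hy
      obtain ⟨m, hm⟩ := hx i
      exact Submodule.mem_one.mpr ⟨m, by rw [latticeForm_apply, hm]; simp⟩
    | zero => simp
    | add y z _ _ hy hz => rw [map_add]; exact add_mem hy hz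
    | smul c y _ hy => rw [map_zsmul]; exact Submodule.smul_mem _ c hy
  · intro hx i
    obtain ⟨m, hm⟩ := Submodule.mem_one.mp (hx _ (Submodule.subset_span ⟨i, rfl⟩))
    exact ⟨m, by rw [← latticeForm_apply, ← hm]; simp⟩

lemma dualSubmodule_lattice [P.IsRootSystem] [P.IsIrreducible] :
    b.latticeForm.dualSubmodule b.lattice = Submodule.span ℤ (Set.range P.root) := by
  rw [lattice_eq_dualSubmodule, ← span_range_toWeightBasis b]
  exact LinearMap.BilinForm.dualSubmodule_dualSubmodule_of_basis _ b.latticeForm_nondegenerate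
    ⟨b.latticeForm_comm⟩ _

/-- Eutaxy in coordinates: x ↦ (β(x,r)) embeds W isometrically into the standard lattice indexed by
R⁺. -/
lemma latticeForm_eq_sum (hP : P.IsInvariantInner) [P.IsRootSystem] [P.IsIrreducible] (x y : E) :
    b.latticeForm x y =
      ∑ i ∈ b.posRoots, inner ℝ x (P.root i) / b.normH * (inner ℝ y (P.root i) / b.normH) := by
  have hh := b.normH_pos.ne'
  rw [latticeForm_apply]
  simp_rw [div_mul_div_comm, ← Finset.sum_div]
  rw [b.sum_inner_mul_inner hP]
  field_simp

lemma exists_int_latticeForm_eq (hP : P.IsInvariantInner) [P.IsRootSystem] [P.IsIrreducible]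
    {x y : E} (hx : x ∈ b.lattice) (hy : y ∈ b.lattice) : ∃ m : ℤ, b.latticeForm x y = m := by
  choose f hf using hx
  choose g hg using hy
  exact ⟨∑ i ∈ b.posRoots, f i * g i, by rw [b.latticeForm_eq_sum hP]; simp [hf, hg]⟩

lemma isIntegralLattice_lattice (hP : P.IsInvariantInner) [P.IsRootSystem] [P.IsIrreducible] :
    ThetaLattice.IsIntegralLattice b.latticeForm b.lattice where
  free := by
    classical
    have := finiteDimensional_of_isRootSystem P
    let e := b.latticeForm.dualBasis b.latticeForm_nondegenerate b.toWeightBasis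
    have hc : Fintype.card b.support = finrank ℝ E := (finrank_eq_card_basis e).symm
    refine ⟨e.reindex (Fintype.equivFinOfCardEq hc), ?_⟩
    rw [Basis.range_reindex, lattice_eq_dualSubmodule, ← span_range_toWeightBasis b]
    exact LinearMap.BilinForm.dualSubmodule_span_of_basis _ _ _
  symm := b.latticeForm_comm
  nondegenerate := b.latticeForm_nondegenerate
  integral _ hx _ hy := b.exists_int_latticeForm_eq hP hx hy

/-- With integers m = β(x,r), the difference β(x,x)/2 − β(w,x) is the sum of the integers (m² −
m)/2. -/
lemma weylVector_mem_shadow (hP : P.IsInvariantInner) [P.IsRootSystem] [P.IsIrreducible] :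
    b.weylVector ∈ ThetaLattice.shadow b.latticeForm b.lattice := by
  intro x hx
  choose f hf using hx
  have h1 : ∀ m : ℤ, ∃ k : ℤ, m * m - m = 2 * k := fun m => by
    obtain ⟨k, hk⟩ := Int.even_mul_pred_self m
    exact ⟨k, by linear_combination hk⟩
  choose g hg using h1
  have hw : b.latticeForm b.weylVector x = ∑ i ∈ b.posRoots, (f i : ℝ) / 2 := by
    rw [latticeForm_apply, weylVector, real_inner_smul_left, sum_inner, Finset.mul_sum,
      Finset.sum_div]
    refine Finset.sum_congr rfl fun i _ => ?_
    rw [← hf, real_inner_comm]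
    ring
  refine ⟨∑ i ∈ b.posRoots, g (f i), ?_⟩
  rw [hw, b.latticeForm_eq_sum hP, Finset.sum_div, ← Finset.sum_sub_distrib]
  push_cast
  refine Finset.sum_congr rfl fun i _ => ?_
  have h : (f i : ℝ) * f i - f i = 2 * g (f i) := by exact_mod_cast hg (f i)
  rw [hf]
  linear_combination h / 2

/-- Two shadow vectors differ by an element of the dual of W, which is the root lattice. -/
lemma sub_weylVector_mem_of_mem_shadow (hP : P.IsInvariantInner) [P.IsRootSystem]
    [P.IsIrreducible] {v : E} (hv : v ∈ ThetaLattice.shadow b.latticeForm b.lattice) :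
    v - b.weylVector ∈ Submodule.span ℤ (Set.range P.root) := by
  rw [← b.dualSubmodule_lattice]
  intro x hx
  obtain ⟨m, hm⟩ := hv x hx
  obtain ⟨k, hk⟩ := b.weylVector_mem_shadow hP x hx
  refine Submodule.mem_one.mpr ⟨k - m, ?_⟩
  rw [LinearMap.map_sub₂]
  simp only [algebraMap_int_eq, eq_intCast, Int.cast_sub]
  linarith

end Base

end RootPairing

/-! ### Multiplicativity of the sign and cosets of the even part -/

namespace ThetaLattice

variable {V : Type*} [AddCommGroup V] [Module ℝ V]

lemma IsSignedPerm.mul {J : Type*} {s : J → V} {g g' : V ≃ₗ[ℝ] V} {σ σ' : Equiv.Perm J}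
    {ε ε' : J → ℤˣ} (h : IsSignedPerm s g σ ε) (h' : IsSignedPerm s g' σ' ε') :
    IsSignedPerm s (g * g') (σ * σ') (fun j => ε (σ' j) * ε' j) := by
  intro j
  rw [LinearEquiv.mul_apply, h' j, map_zsmul, h (σ' j), smul_smul, mul_comm]
  simp

lemma sn_mul {J : Type*} [Fintype J] {s : J → V} (hs : ∀ j, s j ≠ 0) {g g' : V ≃ₗ[ℝ] V}
    (h : ∃ σ ε, IsSignedPerm s g σ ε) (h' : ∃ σ ε, IsSignedPerm s g' σ ε) :
    sn s (g * g') = sn s g * sn s g' := by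
  obtain ⟨σ, ε, h⟩ := h
  obtain ⟨σ', ε', h'⟩ := h'
  rw [sn_eq hs h, sn_eq hs h', sn_eq hs (h.mul h'), Finset.prod_mul_distrib,
    Equiv.prod_comp σ' ε]

lemma sn_one {J : Type*} [Fintype J] {s : J → V} (hs : ∀ j, s j ≠ 0) :
    sn s (1 : V ≃ₗ[ℝ] V) = 1 := by
  rw [sn_eq hs (σ := 1) (ε := 1) (fun j => by simp)]
  simp

/-- `evenPart` is only a set, closed under addition when the form is integral; `A` supplies the
group structure. -/
lemma evenCoset_eq_iff {β : LinearMap.BilinForm ℝ V} {L : Submodule ℤ V} {A : AddSubgroup V}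
    (hA : (A : Set V) = evenPart β L) {u v : V} :
    evenCoset β L u = evenCoset β L v ↔ u - v ∈ A := by
  rw [evenCoset, evenCoset, ← hA]
  constructor
  · intro h
    have hu : u ∈ v +ᵥ (A : Set V) := h ▸ ⟨0, A.zero_mem, by simp⟩
    obtain ⟨a, ha, hau⟩ := hu
    have : u - v = a := by simp [← hau]
    rwa [this]
  · intro h
    ext x
    rw [Set.mem_vadd_set_iff_neg_vadd_mem, Set.mem_vadd_set_iff_neg_vadd_mem]
    simp only [vadd_eq_add, SetLike.mem_coe]
    have : -v + x = (u - v) + (-u + x) := by abel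
    rw [this, A.add_mem_cancel_left h]

end ThetaLattice

/-! ### Weyl group action, signs and the stabilizer of the Weyl vector -/

namespace RootPairing

open Module

variable {ι E N : Type*} [NormedAddCommGroup E] [InnerProductSpace ℝ E]
  [AddCommGroup N] [Module ℝ N] {P : RootPairing ι ℝ E N}

lemma reflection_mem_weylGL (i : ι) : P.reflection i ∈ P.weylGL :=
  Subgroup.subset_closure ⟨i, rfl⟩

lemma exists_perm_of_mem_weylGL {g : E ≃ₗ[ℝ] E} (hg : g ∈ P.weylGL) :
    ∃ π : Equiv.Perm ι, ∀ i, g (P.root i) = P.root (π i) := by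
  induction hg using Subgroup.closure_induction with
  | mem g hg =>
    obtain ⟨i, rfl⟩ := hg
    exact ⟨P.reflectionPerm i, fun j => (P.root_reflectionPerm i j).symm⟩
  | one => exact ⟨1, fun j => by simp⟩
  | mul g g' _ _ h h' =>
    obtain ⟨π, h⟩ := h
    obtain ⟨π', h'⟩ := h'
    exact ⟨π * π', fun j => by rw [LinearEquiv.mul_apply, h', h, Equiv.Perm.mul_apply]⟩
  | inv g _ h =>
    obtain ⟨π, h⟩ := h
    refine ⟨π⁻¹, fun j => ?_⟩
    have := h (π⁻¹ j)
    rw [← Equiv.Perm.mul_apply, mul_inv_cancel, Equiv.Perm.one_apply] at this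
    rw [← this, ← LinearEquiv.mul_apply, inv_mul_cancel, LinearEquiv.coe_one, id]

lemma IsInvariantInner.inner_map_map (hP : P.IsInvariantInner) {g : E ≃ₗ[ℝ] E}
    (hg : g ∈ P.weylGL) (x y : E) : inner ℝ (g x) (g y) = inner ℝ x y := by
  induction hg using Subgroup.closure_induction generalizing x y with
  | mem g hg =>
    obtain ⟨i, rfl⟩ := hg
    exact hP i x y
  | one => rfl
  | mul g g' _ _ h h' => rw [LinearEquiv.mul_apply, LinearEquiv.mul_apply, h, h']
  | inv g _ h =>
    rw [← h, ← LinearEquiv.mul_apply, ← LinearEquiv.mul_apply, mul_inv_cancel]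
    rfl

lemma IsInvariantInner.inner_map_eq (hP : P.IsInvariantInner) {g : E ≃ₗ[ℝ] E}
    (hg : g ∈ P.weylGL) (x y : E) : inner ℝ (g x) y = inner ℝ x (g⁻¹ y) := by
  rw [← hP.inner_map_map (inv_mem hg) (g x) y, ← LinearEquiv.mul_apply, inv_mul_cancel]
  rfl

variable [Fintype ι]

namespace Base

variable (b : P.Base)

lemma mem_posRoots_or_exists (i : ι) : i ∈ b.posRoots ∨ ∃ j ∈ b.posRoots, P.root i = -P.root j := by
  by_cases hi : i ∈ b.posRoots
  · exact Or.inl hi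
  · exact Or.inr ⟨_, b.reflectionPerm_self_mem_posRoots.mpr hi, by simp⟩

lemma root_ne_neg_root {i j : ι} (hi : i ∈ b.posRoots) (hj : j ∈ b.posRoots) :
    P.root i ≠ -P.root j := by
  rw [Ne, root_eq_neg_iff]
  rintro rfl
  exact b.reflectionPerm_self_mem_posRoots.mp hi hj

lemma posStar_ne_zero (j : b.posRoots) : b.posStar j ≠ 0 := P.ne_zero _

open Classical in
-- The signs are given explicitly so that their product counts the length. The induced map on R⁺ is
-- injective because two positive roots are never opposite.
lemma exists_isSignedPerm {g : E ≃ₗ[ℝ] E} (hg : g ∈ P.weylGL) :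
    ∃ σ, ThetaLattice.IsSignedPerm b.posStar g σ
      (fun i => if ∃ j ∈ b.posRoots, g (P.root i) = -P.root j then -1 else 1) := by
  obtain ⟨π, hπ⟩ := exists_perm_of_mem_weylGL hg
  have hex : ∀ i : b.posRoots, ∃ k : b.posRoots, g (P.root i) =
      ((if ∃ j ∈ b.posRoots, g (P.root i) = -P.root j then -1 else 1 : ℤˣ) : ℤ) • P.root k := by
    intro i
    by_cases h : ∃ j ∈ b.posRoots, g (P.root i) = -P.root j
    · obtain ⟨j, hj, hij⟩ := id h
      refine ⟨⟨j, hj⟩, ?_⟩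
      rw [if_pos h, hij]
      simp
    · rcases b.mem_posRoots_or_exists (π i) with hi | hi
      · refine ⟨⟨π i, hi⟩, ?_⟩
        rw [if_neg h, hπ]
        simp
      · exact absurd (hπ i ▸ hi) h
  choose f hf using hex
  have hinj : Function.Injective f := by
    intro i j hij
    have hi := hf i
    have hj := hf j
    rw [← hij] at hj
    have h : g (P.root i) = g (P.root j) ∨ g (P.root i) = g (-P.root j) := by
      rw [map_neg, hi, hj]
      split_ifs <;> simp
    rcases h with h | h
    · exact Subtype.ext (P.root.injective (g.injective h))
    · exact absurd (g.injective h) (b.root_ne_neg_root i.2 j.2)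
  exact ⟨Equiv.ofBijective f (Finite.injective_iff_bijective.mp hinj), hf⟩

lemma sn_eq_neg_one_pow_length {g : E ≃ₗ[ℝ] E} (hg : g ∈ P.weylGL) :
    ThetaLattice.sn b.posStar g = (-1) ^ b.length g := by
  classical
  obtain ⟨σ, hσ⟩ := b.exists_isSignedPerm hg
  rw [ThetaLattice.sn_eq b.posStar_ne_zero hσ, Finset.prod_coe_sort b.posRoots
    (fun i => if ∃ j ∈ b.posRoots, g (P.root i) = -P.root j then (-1 : ℤˣ) else 1),
    Finset.prod_ite, Finset.prod_const, Finset.prod_const_one, mul_one, length,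
    ← Set.ncard_coe_finset]
  simp

lemma sn_mul_of_mem_weylGL {g g' : E ≃ₗ[ℝ] E} (hg : g ∈ P.weylGL) (hg' : g' ∈ P.weylGL) :
    ThetaLattice.sn b.posStar (g * g') =
      ThetaLattice.sn b.posStar g * ThetaLattice.sn b.posStar g' :=
  ThetaLattice.sn_mul b.posStar_ne_zero ((b.exists_isSignedPerm hg).imp fun _ h => ⟨_, h⟩)
    ((b.exists_isSignedPerm hg').imp fun _ h => ⟨_, h⟩)

lemma sn_mul_sn_inv {g : E ≃ₗ[ℝ] E} (hg : g ∈ P.weylGL) :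
    ThetaLattice.sn b.posStar g * ThetaLattice.sn b.posStar g⁻¹ = 1 := by
  rw [← b.sn_mul_of_mem_weylGL hg (inv_mem hg), mul_inv_cancel,
    ThetaLattice.sn_one b.posStar_ne_zero]

lemma sn_inv {g : E ≃ₗ[ℝ] E} (hg : g ∈ P.weylGL) :
    ThetaLattice.sn b.posStar g⁻¹ = ThetaLattice.sn b.posStar g := by
  have h := b.sn_mul_sn_inv hg
  rw [← eq_inv_iff_mul_eq_one] at h
  rw [h, Int.units_inv_eq_self]

lemma length_reflection_of_mem_support [P.IsCrystallographic] [P.IsReduced] {i : ι}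
    (hi : i ∈ b.support) : b.length (P.reflection i) = 1 := by
  have hpos : i ∈ b.posRoots := b.mem_posRoots.mpr (isPos_of_mem_support hi)
  rw [length, Set.ncard_eq_one]
  refine ⟨i, Set.eq_singleton_iff_unique_mem.mpr
    ⟨⟨hpos, i, hpos, P.reflection_apply_self i⟩, ?_⟩⟩
  rintro j ⟨hj, k, hk, hjk⟩
  by_contra hij
  have h := (b.mem_posRoots.mp hj).reflectionPerm hi hij
  rw [← root_reflectionPerm] at hjk
  exact b.root_ne_neg_root (b.mem_posRoots.mpr h) hk hjk

/-- Simple reflections have length 1, every reflection is conjugate to a simple one, and a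
multiplicative sign is constant on conjugates. -/
lemma sn_reflection [P.IsCrystallographic] [P.IsReduced] (i : ι) :
    ThetaLattice.sn b.posStar (P.reflection i) = -1 := by
  refine b.induction_reflect i (p := fun i => ThetaLattice.sn b.posStar (P.reflection i) = -1)
    (fun i hi => ?_) (fun i hi => ?_) fun i j hi hj => ?_
  · rw [reflection_reflectionPerm]
    change ThetaLattice.sn b.posStar (P.reflection i * (P.reflection i * P.reflection i)) = -1
    rwa [← sq, reflection_sq, mul_one]
  · rw [b.sn_eq_neg_one_pow_length (reflection_mem_weylGL i),
      b.length_reflection_of_mem_support hi, pow_one]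
  · have hmem := reflection_mem_weylGL (P := P)
    rw [reflection_reflectionPerm]
    change ThetaLattice.sn b.posStar (P.reflection j * (P.reflection i * P.reflection j)) = -1
    rw [b.sn_mul_of_mem_weylGL (hmem j) (mul_mem (hmem i) (hmem j)),
      b.sn_mul_of_mem_weylGL (hmem i) (hmem j), mul_left_comm, Int.units_mul_self, mul_one, hi]

lemma isEutacticStar_posStar (hP : P.IsInvariantInner) [P.IsRootSystem] [P.IsIrreducible] :
    ThetaLattice.IsEutacticStar b.latticeForm b.lattice b.posStar where
  ne_zero := b.posStar_ne_zero
  mem_dual j := by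
    rw [b.dualSubmodule_lattice]
    exact Submodule.subset_span ⟨j, rfl⟩
  expansion x := by
    have hh := b.normH_pos.ne'
    have h := b.sum_inner_smul_root hP x
    rw [← Finset.sum_coe_sort] at h
    simp_rw [latticeForm_apply, div_eq_inv_mul, mul_smul, ← Finset.smul_sum]
    rw [eq_inv_smul_iff₀ hh]
    exact h.symm

lemma latticeForm_map_map (hP : P.IsInvariantInner) {g : E ≃ₗ[ℝ] E} (hg : g ∈ P.weylGL)
    (x y : E) : b.latticeForm (g x) (g y) = b.latticeForm x y := by
  rw [latticeForm_apply, latticeForm_apply, hP.inner_map_map hg]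

lemma map_mem_lattice (hP : P.IsInvariantInner) {g : E ≃ₗ[ℝ] E} (hg : g ∈ P.weylGL) {x : E}
    (hx : x ∈ b.lattice) : g x ∈ b.lattice := by
  obtain ⟨π, hπ⟩ := exists_perm_of_mem_weylGL (inv_mem hg)
  intro i
  rw [hP.inner_map_eq hg, hπ]
  exact hx _

lemma map_mem_lattice_iff (hP : P.IsInvariantInner) {g : E ≃ₗ[ℝ] E} (hg : g ∈ P.weylGL) {x : E} :
    g x ∈ b.lattice ↔ x ∈ b.lattice := by
  refine ⟨fun h => ?_, b.map_mem_lattice hP hg⟩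
  have := b.map_mem_lattice hP (inv_mem hg) h
  rwa [← LinearEquiv.mul_apply, inv_mul_cancel] at this

/-- The even part of the lattice of `P`, as a subgroup. -/
def evenLattice (hP : P.IsInvariantInner) [P.IsRootSystem] [P.IsIrreducible] : AddSubgroup E where
  carrier := ThetaLattice.evenPart b.latticeForm b.lattice
  add_mem' {x y} hx hy := by
    refine ⟨add_mem hx.1 hy.1, ?_⟩
    obtain ⟨m, hm⟩ := hx.2
    obtain ⟨k, hk⟩ := hy.2
    obtain ⟨l, hl⟩ := b.exists_int_latticeForm_eq hP hx.1 hy.1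
    refine ⟨m + k + l, ?_⟩
    have hc := b.latticeForm_comm y x
    rw [map_add, map_add, LinearMap.add_apply, LinearMap.add_apply]
    push_cast
    linarith
  zero_mem' := ⟨zero_mem _, 0, by simp⟩
  neg_mem' {x} hx := ⟨neg_mem hx.1, by simpa using hx.2⟩

lemma mem_evenLattice (hP : P.IsInvariantInner) [P.IsRootSystem] [P.IsIrreducible] {x : E} :
    x ∈ b.evenLattice hP ↔ x ∈ b.lattice ∧ ∃ m : ℤ, b.latticeForm x x / 2 = m := Iff.rfl

lemma map_mem_evenLattice (hP : P.IsInvariantInner) [P.IsRootSystem] [P.IsIrreducible]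
    {g : E ≃ₗ[ℝ] E} (hg : g ∈ P.weylGL) {x : E} (hx : x ∈ b.evenLattice hP) :
    g x ∈ b.evenLattice hP := by
  rw [mem_evenLattice, b.latticeForm_map_map hP hg]
  exact ⟨b.map_mem_lattice hP hg hx.1, hx.2⟩

lemma image_evenCoset (hP : P.IsInvariantInner) [P.IsRootSystem] [P.IsIrreducible]
    (g : P.weylGL) (v : E) : g • ThetaLattice.evenCoset b.latticeForm b.lattice v =
      ThetaLattice.evenCoset b.latticeForm b.lattice ((g : E ≃ₗ[ℝ] E) v) := by
  have hg : ∀ (g : P.weylGL) (v x : E), x ∈ ThetaLattice.evenCoset b.latticeForm b.lattice v →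
      (g : E ≃ₗ[ℝ] E) x ∈ ThetaLattice.evenCoset b.latticeForm b.lattice ((g : E ≃ₗ[ℝ] E) v) := by
    rintro g v _ ⟨a, ha, rfl⟩
    exact ⟨_, b.map_mem_evenLattice hP g.2 ha, by simp⟩
  ext x
  rw [Set.mem_smul_set_iff_inv_smul_mem]
  constructor
  · intro h
    have := hg g _ _ h
    rwa [show (g : E ≃ₗ[ℝ] E) (g⁻¹ • x) = x from smul_inv_smul g x] at this
  · intro h
    have := hg g⁻¹ _ _ h
    rwa [show (g⁻¹ : P.weylGL).1 ((g : E ≃ₗ[ℝ] E) v) = v from inv_smul_smul g v] at this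

lemma stabilizerInKernel_evenCoset_iff (hP : P.IsInvariantInner) [P.IsRootSystem]
    [P.IsIrreducible] (v : E) :
    ThetaLattice.StabilizerInKernel P.weylGL b.posStar
        (ThetaLattice.evenCoset b.latticeForm b.lattice v) ↔
      ∀ g ∈ P.weylGL, g v - v ∈ b.evenLattice hP → ThetaLattice.sn b.posStar g = 1 := by
  have h : ∀ g : P.weylGL, g ∈ MulAction.stabilizer P.weylGL
      (ThetaLattice.evenCoset b.latticeForm b.lattice v) ↔
      (g : E ≃ₗ[ℝ] E) v - v ∈ b.evenLattice hP := fun g => by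
    rw [MulAction.mem_stabilizer_iff, b.image_evenCoset hP,
      ThetaLattice.evenCoset_eq_iff (A := b.evenLattice hP) rfl]
  simp_rw [ThetaLattice.StabilizerInKernel, h, Subtype.forall]

lemma stabilizerInKernel_smul (c : Set E) (g : P.weylGL)
    (h : ThetaLattice.StabilizerInKernel P.weylGL b.posStar c) :
    ThetaLattice.StabilizerInKernel P.weylGL b.posStar (g • c) := by
  intro k hk
  have h1 : g⁻¹ * k * g ∈ MulAction.stabilizer P.weylGL c := by
    rw [MulAction.mem_stabilizer_iff] at hk ⊢
    rw [mul_smul, mul_smul, hk, inv_smul_smul]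
  have h2 := h _ h1
  rw [Subgroup.coe_mul, Subgroup.coe_mul, b.sn_mul_of_mem_weylGL (mul_mem (g⁻¹).2 k.2) g.2,
    b.sn_mul_of_mem_weylGL (g⁻¹).2 k.2, Subgroup.coe_inv, b.sn_inv g.2] at h2
  rwa [mul_right_comm, Int.units_mul_self, one_mul] at h2

/-- For r in R⁺, (gw − w, r) = (w, g⁻¹r) − (w,r) is an integer multiple of h. Since w has products
in (0,h) with positive roots, the multiple is −1 if g⁻¹r is negative and 0 otherwise. Summing
squares gives β(gw − w, gw − w) = ℓ(g⁻¹). -/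
lemma sn_eq_one_of_map_weylVector_sub_mem (hP : P.IsInvariantInner) [P.IsRootSystem]
    [P.IsIrreducible] [P.IsCrystallographic] [P.IsReduced] {g : E ≃ₗ[ℝ] E} (hg : g ∈ P.weylGL)
    (h : g b.weylVector - b.weylVector ∈ b.evenLattice hP) : ThetaLattice.sn b.posStar g = 1 := by
  classical
  have hh := b.normH_pos
  obtain ⟨hx, m, hm⟩ := h
  obtain ⟨π, hπ⟩ := exists_perm_of_mem_weylGL (inv_mem hg)
  have hk : ∀ i ∈ b.posRoots, inner ℝ (g b.weylVector - b.weylVector) (P.root i) / b.normH *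
      (inner ℝ (g b.weylVector - b.weylVector) (P.root i) / b.normH) =
      if ∃ j ∈ b.posRoots, g⁻¹ (P.root i) = -P.root j then 1 else 0 := by
    intro i hi
    obtain ⟨k, hk⟩ := hx i
    rw [hk]
    rw [inner_sub_left, hP.inner_map_eq hg, div_eq_iff hh.ne'] at hk
    have h1 := b.inner_weylVector_pos hP hi
    have h2 := b.inner_weylVector_lt hP hi
    split_ifs with hj
    · obtain ⟨j, hj, hij⟩ := hj
      have h3 := b.inner_weylVector_pos hP hj
      have h4 := b.inner_weylVector_lt hP hj
      rw [hij, inner_neg_right] at hk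
      have h5 : (k : ℝ) < 0 := by nlinarith
      have h6 : (-2 : ℝ) < k := by nlinarith
      have h7 : k < 0 := by exact_mod_cast h5
      have h8 : -2 < k := by exact_mod_cast h6
      have : k = -1 := by omega
      subst this
      norm_num
    · rw [hπ] at hj hk
      have hj' := (b.mem_posRoots_or_exists (π i)).resolve_right hj
      have h3 := b.inner_weylVector_pos hP hj'
      have h4 := b.inner_weylVector_lt hP hj'
      have h5 : (k : ℝ) < 1 := by nlinarith
      have h6 : (-1 : ℝ) < k := by nlinarith
      have h7 : k < 1 := by exact_mod_cast h5
      have h8 : -1 < k := by exact_mod_cast h6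
      have : k = 0 := by omega
      subst this
      norm_num
  have hl : b.latticeForm (g b.weylVector - b.weylVector) (g b.weylVector - b.weylVector) =
      b.length g⁻¹ := by
    rw [b.latticeForm_eq_sum hP, Finset.sum_congr rfl hk, Finset.sum_boole, length,
      ← Set.ncard_coe_finset]
    simp
  rw [hl] at hm
  have he : (b.length g⁻¹ : ℤ) = 2 * m := by
    have : (b.length g⁻¹ : ℝ) = 2 * m := by linarith
    exact_mod_cast this
  rw [← b.sn_inv hg, b.sn_eq_neg_one_pow_length (inv_mem hg)]
  refine Even.neg_one_pow ?_
  rw [← Int.even_coe_nat, he]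
  exact even_two_mul m

end Base

end RootPairing

/-! ### Dominant long roots, the alcove of w and uniqueness of the orbit -/

namespace RootPairing

open Module

variable {ι E N : Type*} [NormedAddCommGroup E] [InnerProductSpace ℝ E]
  [AddCommGroup N] [Module ℝ N] {P : RootPairing ι ℝ E N}

/-- The long roots span. -/
lemma IsInvariantInner.span_longRoots (hP : P.IsInvariantInner) [P.IsIrreducible] {i : ι}
    (hi : ∀ j, inner ℝ (P.root j) (P.root j) ≤ inner ℝ (P.root i) (P.root i)) :
    Submodule.span ℝ (P.root ''
      {i | ∀ j, inner ℝ (P.root j) (P.root j) ≤ inner ℝ (P.root i) (P.root i)}) = ⊤ := by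
  refine IsIrreducible.eq_top_of_invtSubmodule_reflection (P := P) _ (fun k => ?_) ?_
  · rw [End.mem_invtSubmodule, Submodule.span_le]
    rintro _ ⟨j, hj, rfl⟩
    refine Submodule.subset_span ⟨P.reflectionPerm k j, fun l => ?_, root_reflectionPerm ..⟩
    rw [root_reflectionPerm, hP]
    exact hj l
  · rw [Submodule.ne_bot_iff]
    exact ⟨P.root i, Submodule.subset_span ⟨i, hi, rfl⟩, P.ne_zero i⟩

/-- A vector having nonnegative inner product with the positive roots has positive inner product
with a long root that is dominant. -/
lemma IsInvariantInner.exists_dominant_longRoot [Fintype ι] (hP : P.IsInvariantInner)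
    [P.IsRootSystem] [P.IsIrreducible] [P.IsCrystallographic] [P.IsReduced] (b : P.Base) {q : E}
    (hq : q ≠ 0) (hq' : ∀ i ∈ b.posRoots, 0 ≤ inner ℝ q (P.root i)) :
    ∃ i ∈ b.posRoots, (∀ j, inner ℝ (P.root j) (P.root j) ≤ inner ℝ (P.root i) (P.root i)) ∧
      0 < inner ℝ q (P.root i) ∧ ∀ j ∈ b.posRoots, 0 ≤ inner ℝ (P.root j) (P.root i) := by
  classical
  have := nonempty_of_isIrreducible P
  let F : Finset ι := Finset.univ.filter fun i =>
    ∀ j, inner ℝ (P.root j) (P.root j) ≤ inner ℝ (P.root i) (P.root i)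
  have hF : ∀ i, i ∈ F ↔ ∀ j, inner ℝ (P.root j) (P.root j) ≤ inner ℝ (P.root i) (P.root i) :=
    fun i => by simp [F]
  have hFrefl : ∀ k, ∀ i ∈ F, P.reflectionPerm k i ∈ F := by
    intro k i hi
    rw [hF] at hi ⊢
    rwa [root_reflectionPerm, hP]
  obtain ⟨i₀, hi₀⟩ := Finite.exists_max fun i => inner ℝ (P.root i) (P.root i)
  obtain ⟨i₁, hi₁, hmax₁⟩ :=
    F.exists_max_image (fun i => inner ℝ q (P.root i)) ⟨i₀, (hF i₀).mpr hi₀⟩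
  -- Negatives of long roots are long, so a maximum ≤ 0 would make q orthogonal to all long roots,
  -- which span.
  have hpos : 0 < inner ℝ q (P.root i₁) := by
    by_contra! hle
    have h0 : ∀ i ∈ F, inner ℝ q (P.root i) = 0 := by
      intro i hi
      have h1 := hmax₁ i hi
      have h2 := hmax₁ _ (hFrefl i i hi)
      rw [root_reflectionPerm, reflection_apply_self, inner_neg_right] at h2
      linarith
    have hle : Submodule.span ℝ (P.root ''
        {i | ∀ j, inner ℝ (P.root j) (P.root j) ≤ inner ℝ (P.root i) (P.root i)}) ≤
        LinearMap.ker (innerₗ E q) := by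
      rw [Submodule.span_le]
      rintro _ ⟨i, hi, rfl⟩
      exact h0 i ((hF i).mpr hi)
    rw [hP.span_longRoots hi₀] at hle
    have : inner ℝ q q = 0 := hle (Submodule.mem_top (x := q))
    exact hq (inner_self_eq_zero.mp this)
  let F' : Finset ι := F.filter fun i => inner ℝ q (P.root i) = inner ℝ q (P.root i₁)
  -- Ties among the maximizers are broken by the product with w, which is strictly positive on
  -- positive roots.
  obtain ⟨i, hi, hmax⟩ := F'.exists_max_image (fun i => inner ℝ b.weylVector (P.root i))
    ⟨i₁, Finset.mem_filter.mpr ⟨hi₁, rfl⟩⟩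
  obtain ⟨hiF, hqi⟩ := Finset.mem_filter.mp hi
  refine ⟨i, ?_, (hF i).mp hiF, hqi ▸ hpos, fun j hj => ?_⟩
  · by_contra hi
    have h := hq' _ (b.reflectionPerm_self_mem_posRoots.mpr hi)
    rw [root_reflectionPerm, reflection_apply_self, inner_neg_right, hqi] at h
    linarith
  -- Reflecting in `j` would add a positive multiple of a positive root: the result is still long,
  -- its product with q does not drop, and its product with w strictly grows.
  · by_contra! hlt
    have hc : P.pairing i j < 0 := by
      have h1 := hP.two_mul_inner_root j (P.root i)
      rw [root_coroot'_eq_pairing, real_inner_comm] at h1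
      have h2 := inner_root_self_pos (P := P) j
      by_contra! h3
      nlinarith [mul_nonneg h3 h2.le]
    have hexp : ∀ x : E, inner ℝ x (P.root (P.reflectionPerm j i)) =
        inner ℝ x (P.root i) - P.pairing i j * inner ℝ x (P.root j) := by
      intro x
      rw [root_reflectionPerm, reflection_apply_root, inner_sub_right, real_inner_smul_right]
    have hge : inner ℝ q (P.root (P.reflectionPerm j i)) = inner ℝ q (P.root i₁) := by
      refine le_antisymm (hmax₁ _ (hFrefl j i hiF)) ?_
      rw [hexp, hqi]
      nlinarith [hq' j hj]
    have hw := hmax _ (Finset.mem_filter.mpr ⟨hFrefl j i hiF, hge⟩)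
    rw [hexp] at hw
    nlinarith [b.inner_weylVector_pos hP hj]

variable [Fintype ι]

namespace Base

variable (b : P.Base)

/-- Every other positive root pairs with a dominant long root to 0 or 1, where p² − p vanishes; only
the term p = 2 of the root itself survives. -/
lemma normH_eq_of_dominant_longRoot (hP : P.IsInvariantInner) [P.IsRootSystem]
    [P.IsIrreducible] [P.IsCrystallographic] {i : ι} (hi : i ∈ b.posRoots)
    (hlong : ∀ j, inner ℝ (P.root j) (P.root j) ≤ inner ℝ (P.root i) (P.root i))
    (hdom : ∀ j ∈ b.posRoots, 0 ≤ inner ℝ (P.root j) (P.root i)) :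
    b.normH = inner ℝ b.weylVector (P.root i) + inner ℝ (P.root i) (P.root i) / 2 := by
  have hr := inner_root_self_pos (P := P) i
  have hterm : ∀ j ∈ b.posRoots, j ≠ i → P.pairing j i ^ 2 - P.pairing j i = 0 := by
    intro j hj hji
    have h1 := hP.two_mul_inner_root i (P.root j)
    rw [root_coroot'_eq_pairing] at h1
    have h2 := hdom j hj
    have hlt : inner ℝ (P.root j) (P.root i) < inner ℝ (P.root i) (P.root i) := by
      have h3 : 0 < inner ℝ (P.root j - P.root i) (P.root j - P.root i) :=
        real_inner_self_pos.mpr (sub_ne_zero.mpr fun h => hji (P.root.injective h))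
      rw [real_inner_sub_sub_self] at h3
      linarith [hlong j]
    have hm : P.pairing j i = P.pairingIn ℤ j i := by
      rw [← P.algebraMap_pairingIn ℤ]
      simp
    have h4 : (-1 : ℝ) < P.pairing j i := by nlinarith
    have h5 : P.pairing j i < 2 := by nlinarith
    rw [hm] at h4 h5 ⊢
    have h6 : -1 < P.pairingIn ℤ j i := by exact_mod_cast h4
    have h7 : P.pairingIn ℤ j i < 2 := by exact_mod_cast h5
    have h8 : P.pairingIn ℤ j i = 0 ∨ P.pairingIn ℤ j i = 1 := by omega
    rcases h8 with h8 | h8 <;> simp [h8]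
  have h := b.normH_sub_inner_weylVector hP i
  rw [Finset.sum_eq_single_of_mem i hi hterm, pairing_same] at h
  linarith

/-- Since w has value 1 on simple coroots and u has positive integral values there, u − w is
dominant. If it is non-zero, it has value at least 1 on the coroot of some dominant long root r, so
(u,r) ≥ (w,r) + (r,r)/2 = h, a contradiction. -/
lemma eq_weylVector_of_inner_mem_Ioo (hP : P.IsInvariantInner) [P.IsRootSystem]
    [P.IsIrreducible] [P.IsCrystallographic] [P.IsReduced] {u : E}
    (hu : u - b.weylVector ∈ Submodule.span ℤ (Set.range P.root))
    (hu' : ∀ i ∈ b.posRoots, inner ℝ u (P.root i) ∈ Set.Ioo 0 b.normH) : u = b.weylVector := by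
  by_contra hne
  have hdom : ∀ i ∈ b.posRoots, 0 ≤ inner ℝ (u - b.weylVector) (P.root i) := by
    refine fun i hi => inner_root_nonneg_of_support (b := b) (fun i hi => ?_) hi
    have hr := inner_root_self_pos (P := P) i
    have h1 := hP.two_mul_inner_root i (u - b.weylVector)
    have h2 := hP.two_mul_inner_root i u
    obtain ⟨m, hm⟩ := exists_int_coroot'_eq i hu
    have h3 := (hu' i (b.mem_posRoots.mpr (isPos_of_mem_support hi))).1
    have h4 : P.coroot' i u = m + 1 := by
      rw [← b.coroot'_weylVector_of_mem_support hi, ← hm, map_sub]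
      ring
    rw [h4] at h2
    have h5 : (-1 : ℝ) < m := by nlinarith
    have h6 : -1 < m := by exact_mod_cast h5
    have h7 : (0 : ℝ) ≤ m := by exact_mod_cast (by omega : 0 ≤ m)
    rw [hm] at h1
    nlinarith [mul_nonneg h7 hr.le]
  obtain ⟨i, hi, hlong, hpos, hidom⟩ :=
    hP.exists_dominant_longRoot b (sub_ne_zero.mpr hne) hdom
  have hr := inner_root_self_pos (P := P) i
  have hh := b.normH_eq_of_dominant_longRoot hP hi hlong hidom
  have h1 := hP.two_mul_inner_root i (u - b.weylVector)
  obtain ⟨m, hm⟩ := exists_int_coroot'_eq i hu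
  rw [hm] at h1
  have h2 : (0 : ℝ) < m := by
    by_contra! h
    nlinarith [mul_nonneg (neg_nonneg.mpr h) hr.le]
  have h3 : (1 : ℝ) ≤ m := by exact_mod_cast (by exact_mod_cast h2 : 0 < m)
  have h4 := (hu' i hi).2
  rw [inner_sub_left] at h1
  nlinarith [mul_nonneg (sub_nonneg.mpr h3) hr.le]

/-- The vector is the translation part of the reflection in the hyperplane (x,r) = kh. For k = 1
half its β-norm is 2h/(r,r), an integer because h − (w,r) is an integral multiple of (r,r)/2 and w
is integral on coroots. -/
lemma smul_root_mem_evenLattice (hP : P.IsInvariantInner) [P.IsRootSystem]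
    [P.IsIrreducible] [P.IsCrystallographic] [P.IsReduced] (i : ι) (k : ℤ) :
    (2 * (k * b.normH) / inner ℝ (P.root i) (P.root i)) • P.root i ∈ b.evenLattice hP := by
  have hr := (inner_root_self_pos (P := P) i).ne'
  have hh := b.normH_pos.ne'
  suffices h : (2 * b.normH / inner ℝ (P.root i) (P.root i)) • P.root i ∈ b.evenLattice hP by
    have := zsmul_mem h k
    rw [← Int.cast_smul_eq_zsmul ℝ, smul_smul] at this
    convert this using 2
    ring
  refine ⟨fun j => ⟨P.pairingIn ℤ j i, ?_⟩, ?_⟩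
  · have h := hP.two_mul_inner_root i (P.root j)
    have hm : P.pairing j i = P.pairingIn ℤ j i := by
      rw [← P.algebraMap_pairingIn ℤ]
      simp
    rw [root_coroot'_eq_pairing, hm, real_inner_comm] at h
    rw [real_inner_smul_left]
    field_simp
    linarith
  · obtain ⟨k, hk, -⟩ := b.exists_int_normH_eq hP i
    obtain ⟨m, hm⟩ := b.exists_int_coroot'_weylVector i
    have h := hP.two_mul_inner_root i b.weylVector
    rw [hm] at h
    refine ⟨m + k, ?_⟩
    rw [latticeForm_apply, real_inner_smul_left, real_inner_smul_right]
    push_cast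
    field_simp
    linarith

lemma shadow_map_mem (hP : P.IsInvariantInner) {g : E ≃ₗ[ℝ] E} (hg : g ∈ P.weylGL) {v : E}
    (hv : v ∈ ThetaLattice.shadow b.latticeForm b.lattice) :
    g v ∈ ThetaLattice.shadow b.latticeForm b.lattice := by
  intro x hx
  have h := hv _ (b.map_mem_lattice hP (inv_mem hg) hx)
  rw [← b.latticeForm_map_map hP (inv_mem hg) x, ← b.latticeForm_map_map hP (inv_mem hg) (g v),
    ← LinearEquiv.mul_apply, inv_mul_cancel]
  exact h

lemma shadow_sub_mem (hP : P.IsInvariantInner) [P.IsRootSystem] [P.IsIrreducible] {v x : E}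
    (hv : v ∈ ThetaLattice.shadow b.latticeForm b.lattice) (hx : x ∈ b.lattice) :
    v - x ∈ ThetaLattice.shadow b.latticeForm b.lattice := by
  intro y hy
  obtain ⟨m, hm⟩ := hv y hy
  obtain ⟨k, hk⟩ := b.exists_int_latticeForm_eq hP hx hy
  refine ⟨m + k, ?_⟩
  rw [LinearMap.map_sub₂]
  push_cast
  linarith

/-- On such a hyperplane the reflection in r would move v by an element of W_ev, although its sign
is −1. -/
lemma inner_ne_int_mul_normH (hP : P.IsInvariantInner) [P.IsRootSystem] [P.IsIrreducible]
    [P.IsCrystallographic] [P.IsReduced] {v : E}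
    (hv : ∀ g ∈ P.weylGL, g v - v ∈ b.evenLattice hP → ThetaLattice.sn b.posStar g = 1)
    (i : ι) (k : ℤ) : inner ℝ v (P.root i) ≠ k * b.normH := by
  intro h
  have hr := (inner_root_self_pos (P := P) i).ne'
  have h1 := hv _ (reflection_mem_weylGL i) (by
    have h2 := hP.two_mul_inner_root i v
    rw [h] at h2
    rw [reflection_apply, sub_sub_cancel_left, neg_mem_iff, eq_div_of_mul_eq hr h2.symm]
    exact b.smul_root_mem_evenLattice hP i k)
  rw [b.sn_reflection] at h1
  exact absurd h1 (by decide)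

lemma exists_map_sub_weylVector_mem (hP : P.IsInvariantInner) [P.IsRootSystem]
    [P.IsIrreducible] [P.IsCrystallographic] [P.IsReduced] {v : E}
    (hv : v ∈ ThetaLattice.shadow b.latticeForm b.lattice)
    (hv' : ∀ g ∈ P.weylGL, g v - v ∈ b.evenLattice hP → ThetaLattice.sn b.posStar g = 1) :
    ∃ g ∈ P.weylGL, g v - b.weylVector ∈ b.evenLattice hP := by
  have := finiteDimensional_of_isRootSystem P
  have := FiniteDimensional.proper ℝ E
  have hh := b.normH_pos
  -- S is the orbit of v under W_ev ⋊ G.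
  let S : Set E := {u | ∃ g ∈ P.weylGL, g v - u ∈ b.evenLattice hP}
  have hvS : v ∈ S := ⟨1, one_mem _, by simp [zero_mem]⟩
  have hSQ : ∀ u ∈ S, u - b.weylVector ∈ Submodule.span ℤ (Set.range P.root) := by
    rintro u ⟨g, hg, hu⟩
    refine b.sub_weylVector_mem_of_mem_shadow hP ?_
    have := b.shadow_sub_mem hP (b.shadow_map_mem hP hg hv) hu.1
    rwa [sub_sub_cancel] at this
  have hSne : ∀ u ∈ S, ∀ i, ∀ k : ℤ, inner ℝ u (P.root i) ≠ k * b.normH := by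
    rintro u ⟨g, hg, hu⟩ i k h
    obtain ⟨π, hπ⟩ := exists_perm_of_mem_weylGL (inv_mem hg)
    obtain ⟨m, hm⟩ := hu.1 i
    rw [div_eq_iff hh.ne', inner_sub_left, hP.inner_map_eq hg, hπ, h] at hm
    refine b.inner_ne_int_mul_normH hP hv' (π i) (m + k) ?_
    push_cast
    linarith
  have hSrefl : ∀ u ∈ S, ∀ i, ∀ k : ℤ, u + (2 * (k * b.normH - inner ℝ u (P.root i)) /
      inner ℝ (P.root i) (P.root i)) • P.root i ∈ S := by
    rintro u ⟨g, hg, hu⟩ i k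
    have hr := (inner_root_self_pos (P := P) i).ne'
    refine ⟨P.reflection i * g, mul_mem (reflection_mem_weylGL i) hg, ?_⟩
    have h1 := sub_mem (b.map_mem_evenLattice hP (reflection_mem_weylGL i) hu)
      (b.smul_root_mem_evenLattice hP i k)
    convert h1 using 1
    have h2 : P.reflection i u = u - (2 * inner ℝ u (P.root i) /
        inner ℝ (P.root i) (P.root i)) • P.root i := by
      rw [reflection_apply, eq_div_of_mul_eq hr (hP.two_mul_inner_root i u).symm]
    rw [map_sub, h2, LinearEquiv.mul_apply, mul_sub, sub_div, sub_smul]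
    abel
  -- A point of S closest to w exists because S lies in the discrete set w + Q.
  obtain ⟨u, ⟨huS, -⟩, hmin⟩ : ∃ u ∈ {u | u ∈ S ∧ ‖u - b.weylVector‖ ≤ ‖v - b.weylVector‖},
      ∀ u' ∈ {u | u ∈ S ∧ ‖u - b.weylVector‖ ≤ ‖v - b.weylVector‖},
        ‖u - b.weylVector‖ ≤ ‖u' - b.weylVector‖ := by
    refine Set.exists_min_image _ (fun u => ‖u - b.weylVector‖) ?_ ⟨v, hvS, le_rfl⟩
    have hfin := ZSpan.setFinite_inter b.toWeightBasis
      (Metric.isBounded_closedBall (x := (0 : E)) (r := ‖v - b.weylVector‖))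
    rw [b.span_range_toWeightBasis] at hfin
    refine (hfin.image (fun x => x + b.weylVector)).subset ?_
    rintro u ⟨hu, hle⟩
    exact ⟨u - b.weylVector, ⟨by simpa using hle, hSQ u hu⟩, sub_add_cancel _ _⟩
  have hmin' : ∀ u' ∈ S, ‖u - b.weylVector‖ ≤ ‖u' - b.weylVector‖ := by
    intro u' hu'
    rcases le_total ‖u' - b.weylVector‖ ‖v - b.weylVector‖ with h | h
    · exact hmin u' ⟨hu', h⟩
    · exact (hmin v ⟨hvS, le_rfl⟩).trans h
  -- If a hyperplane separated u from w, reflecting u in it would give a point of S strictly closer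
  -- to w.
  have hside : ∀ i, ∀ k : ℤ, 0 ≤ (k * b.normH - inner ℝ u (P.root i)) *
      (k * b.normH - inner ℝ b.weylVector (P.root i)) := by
    intro i k
    have hr := inner_root_self_pos (P := P) i
    have h := hmin' _ (hSrefl u huS i k)
    set t := 2 * (k * b.normH - inner ℝ u (P.root i)) / inner ℝ (P.root i) (P.root i) with ht
    rw [← sq_le_sq₀ (norm_nonneg _) (norm_nonneg _), ← real_inner_self_eq_norm_sq,
      ← real_inner_self_eq_norm_sq, add_sub_right_comm, real_inner_add_add_self,
      real_inner_smul_left, real_inner_smul_right, real_inner_smul_right,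
      inner_sub_left _ _ (P.root i)] at h
    have ht' : t * inner ℝ (P.root i) (P.root i) =
        2 * (k * b.normH - inner ℝ u (P.root i)) := div_mul_cancel₀ _ hr.ne'
    rw [ht'] at h
    have h2 : 0 ≤ t * (k * b.normH - inner ℝ b.weylVector (P.root i)) := by linarith
    have h3 := mul_nonneg h2 hr.le
    have h4 : t * (k * b.normH - inner ℝ b.weylVector (P.root i)) *
        inner ℝ (P.root i) (P.root i) = 2 * ((k * b.normH - inner ℝ u (P.root i)) *
          (k * b.normH - inner ℝ b.weylVector (P.root i))) := by
      linear_combination (k * b.normH - inner ℝ b.weylVector (P.root i)) * ht'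
    linarith
  have huw : u = b.weylVector := by
    -- The hyperplanes k = 0 and k = 1 suffice to bound the alcove; strictness holds because S meets
    -- none of them.
    refine b.eq_weylVector_of_inner_mem_Ioo hP (hSQ u huS) fun i hi => ⟨?_, ?_⟩
    · refine lt_of_le_of_ne ?_ fun h => hSne u huS i 0 (by simpa using h.symm)
      have h1 := hside i 0
      have h2 := b.inner_weylVector_pos hP hi
      simp only [Int.cast_zero, zero_mul, zero_sub, neg_mul_neg] at h1
      exact nonneg_of_mul_nonneg_left h1 h2
    · refine lt_of_le_of_ne ?_ fun h => hSne u huS i 1 (by simpa using h)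
      have h1 := hside i 1
      have h2 := b.inner_weylVector_lt hP hi
      simp only [Int.cast_one, one_mul] at h1
      exact sub_nonneg.mp (nonneg_of_mul_nonneg_left h1 (sub_pos.mpr h2))
  exact huw ▸ huS

lemma isExtremalStar_posStar (hP : P.IsInvariantInner) [P.IsRootSystem] [P.IsIrreducible]
    [P.IsCrystallographic] [P.IsReduced] :
    ThetaLattice.IsExtremalStar P.weylGL b.latticeForm b.lattice b.posStar where
  lattice := b.isIntegralLattice_lattice hP
  star := b.isEutacticStar_posStar hP
  isometry _ hg x y := b.latticeForm_map_map hP hg x y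
  maps_lattice _ hg _ := b.map_mem_lattice_iff hP hg
  signedPerm _ hg := (b.exists_isSignedPerm hg).imp fun _ h => ⟨_, h⟩
  existsUnique_orbit := by
    have hw := (b.stabilizerInKernel_evenCoset_iff hP b.weylVector).mpr
      fun g hg h => b.sn_eq_one_of_map_weylVector_sub_mem hP hg h
    refine ⟨MulAction.orbit P.weylGL
      (ThetaLattice.evenCoset b.latticeForm b.lattice b.weylVector),
      ⟨⟨_, ⟨_, b.weylVector_mem_shadow hP, rfl⟩, rfl⟩, ?_⟩, ?_⟩
    · rintro _ ⟨g, rfl⟩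
      exact b.stabilizerInKernel_smul _ g hw
    · rintro _ ⟨⟨_, ⟨v, hv, rfl⟩, rfl⟩, hO⟩
      have hv' := (b.stabilizerInKernel_evenCoset_iff hP v).mp (hO _ (MulAction.mem_orbit_self _))
      obtain ⟨g, hg, h⟩ := b.exists_map_sub_weylVector_mem hP hv hv'
      rw [← ThetaLattice.evenCoset_eq_iff (A := b.evenLattice hP) rfl] at h
      rw [← h, ← b.image_evenCoset hP ⟨g, hg⟩ v, MulAction.orbit_smul]

end Base

end RootPairing

end

theorem mainTheorem3
    {ι E N : Type*} [Fintype ι]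
    [NormedAddCommGroup E] [InnerProductSpace ℝ E] [AddCommGroup N] [Module ℝ N]
    (P : RootPairing ι ℝ E N)
    [P.IsRootSystem] [P.IsCrystallographic] [P.IsReduced] [P.IsIrreducible]
    (hP : ∀ i x y, inner ℝ (P.reflection i x) (P.reflection i y) = inner ℝ x y)
    (b : P.Base) :
    ThetaLattice.IsExtremalStar P.weylGL b.latticeForm b.lattice b.posStar ∧
      (∀ g ∈ P.weylGL, ThetaLattice.sn b.posStar g = (-1) ^ b.length g) ∧
      b.weylVector ∈ ThetaLattice.shadow b.latticeForm b.lattice ∧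
      ThetaLattice.StabilizerInKernel P.weylGL b.posStar
        (ThetaLattice.evenCoset b.latticeForm b.lattice b.weylVector) := by
  have hP : P.IsInvariantInner := hP
  exact ⟨b.isExtremalStar_posStar hP, fun g hg => b.sn_eq_neg_one_pow_length hg,
    b.weylVector_mem_shadow hP, (b.stabilizerInKernel_evenCoset_iff hP b.weylVector).mpr
      fun g hg h => b.sn_eq_one_of_map_weylVector_sub_mem hP hg h⟩
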